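/- Consider the Kauffman–Jones version of $SU(2)$ Chern–Simons theory at level $4$, that is, the unitary recoupling theory of the Kauffman bracket with charges $0,1,2,3,4$ and $A=i\,e^{i\pi/12}$ (so $A^4=e^{i\pi/3}$). Let $V$ be the fusion space of four anyons of charge $2$ with trivial total charge, with orthonormal basis $|0\rangle,|2\rangle,|4\rangle$ given by the common charge $x$ of the pairs $(1,2)$ and $(3,4)$ (normalized trees). On $V$ consider: - the braid $\sigma_1$ (exchange of anyons $1,2$), which is diagonal with entries $R^{22}_x$, where $R^{ab}_c=(-1)^{\frac{a+b-c}{2}}A^{\frac{a(a+2)+b(b+2)-c(c+2)}{2}}$; - the braid $\sigma_2=\mathsf F^{-1}\sigma_1\mathsf F$ (exchange of anyons $2,3$), where $\mathsf F$ is the $F$-matrix of unitary $6j$-symbols from the trees $(12)(34)$ to the trees $(23)(41)$; - the Freedman fusion operation $\Phi$: a pair of anyons of charge $4$ is created out of the vacuum between anyons $2$ and $3$, one of them is fused into anyon $2$ and the other one into anyon $3$, both outcomes having charge $2$. Let $e_1=\frac{|0\rangle+|4\rangle}{\sqrt2}$, $e_2=|2\rangle$, $e_3=\frac{|0\rangle-|4\rangle}{\sqrt2}$,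 and say that an operation $T$ on $V$ realizes a $3\times3$ matrix $M$ up to phase if $T$ has matrix $cM$ with respect to $(e_1,e_2,e_3)$ for some $c\in\mathbb C$ with $|c|=1$. Put $$\tilde G_1=\begin{pmatrix}0&0&e^{7i\pi/9}\\0&-e^{4i\pi/9}&0\\e^{7i\pi/9}&0&0\end{pmatrix},\qquad \tilde G_2=\begin{pmatrix}0&e^{7i\pi/9}&0\\e^{7i\pi/9}&0&0\\0&0&-e^{4i\pi/9}\end{pmatrix},$$ $$\widetilde{FUM}=\mathrm{diag}\bigl(-e^{2i\pi/3},-e^{2i\pi/3},e^{2i\pi/3}\bigr),\qquad N=\mathrm{diag}\bigl(e^{8i\pi/9},e^{8i\pi/9},e^{2i\pi/9}\bigr).$$ The Blichfeldt generators of the finite group $D(18,1,1;2,1,1)\subset SU(3)$ are $$F(18,1,1)=\mathrm{diag}\bigl(e^{i\pi/9},e^{i\pi/9},e^{-2i\pi/9}\bigr),\quad E=\begin{pmatrix}0&1&0\\0&0&1\\1&0&0\end{pmatrix},\quad \tilde B=\begin{pmatrix}-1&0&0\\0&0&-1\\0&-1&0\end{pmatrix}.$$ **Theorem 3.** $(e_1,e_2,e_3)$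 is an orthonormal basis of $V$, and $\sigma_1,\sigma_2,\Phi$ realize $\tilde G_1,\tilde G_2,\widetilde{FUM}$ up to phase, respectively. The three Blichfeldt generators of $D(18,1,1;2,1,1)$ are realized up to phase by braiding and Freedman fusion operations on four anyons of charge $2$, as follows (in a product of operations the rightmost factor is performed first): 1. $F(18,1,1)=(\widetilde{FUM})^{3}N^{-1}$ with $N=\tilde G_2^{-4}$, and $\Phi^3\sigma_2^4$ realizes $F(18,1,1)$ up to phase; 2. $E=\tilde G_2^{9}\tilde G_1^{9}$, and $\sigma_2^9\sigma_1^9$ realizes $E$ up to phase; 3. $\tilde B=\tilde G_2\tilde G_1\tilde G_2$, and $\sigma_2\sigma_1\sigma_2$ realizes $\tilde B$ up to phase. -/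

import Mathlib

noncomputable section

namespace KauffmanJones

/-! ### Recoupling theory of the Kauffman bracket at level `k`

Topological charges are `0, 1, …, k`. -/

/-- The Kauffman variable `A = i e^{iπ/(2(k+2))}`, a value for which the loop value
`-A² - A⁻² = 2 cos (π/(k+2))` and all quantum dimensions are positive (unitary theory). -/
def kauffmanA (k : ℕ) : ℂ := Complex.I * Complex.exp (Complex.I * Real.pi / (2 * (k + 2)))

/-- The quantum integer `[n] = (A^{2n} - A^{-2n}) / (A² - A⁻²)`, as a real number
(`qint_eq` is the equality with this expression). -/
def qint (k n : ℕ) : ℝ :=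
  (-1) ^ (n + 1) * Real.sin (n * Real.pi / (k + 2)) / Real.sin (Real.pi / (k + 2))

/-- `A² = -e^{iπ/(k+2)}`, in the form of a formula for the even powers of `A`. -/
theorem kauffmanA_zpow (k : ℕ) (n : ℤ) :
    kauffmanA k ^ (2 * n) =
      (-1) ^ n * Complex.exp ((n * Real.pi / (k + 2) : ℝ) * Complex.I) := by
  have h2 : kauffmanA k ^ (2 : ℤ) = -1 * Complex.exp ((Real.pi / (k + 2) : ℝ) * Complex.I) := by
    have hk : ((k : ℂ) + 2) ≠ 0 := by exact_mod_cast (by omega : k + 2 ≠ 0)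
    rw [kauffmanA, zpow_ofNat, mul_pow, Complex.I_sq, ← Complex.exp_nat_mul]
    congr 2
    push_cast
    field_simp
  rw [zpow_mul, h2, mul_zpow, ← Complex.exp_int_mul]
  congr 2
  push_cast
  ring

/-- `qint` is the usual quantum integer in the variable `A`. -/
theorem qint_eq (k n : ℕ) :
    (qint k n : ℂ) = (kauffmanA k ^ (2 * (n : ℤ)) - kauffmanA k ^ (-(2 * (n : ℤ)))) /
      (kauffmanA k ^ (2 : ℤ) - kauffmanA k ^ (-2 : ℤ)) := by
  have key : ∀ m : ℤ, kauffmanA k ^ (2 * m) - kauffmanA k ^ (-(2 * m)) =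
      (-1) ^ m * (2 * Complex.I) * (Real.sin (m * Real.pi / (k + 2)) : ℝ) := by
    intro m
    rw [← mul_neg, kauffmanA_zpow, kauffmanA_zpow, Complex.ofReal_sin, Complex.sin]
    have h1 : ((-1 : ℂ)) ^ (-m) = (-1) ^ m := by
      rw [← inv_zpow']; norm_num
    have h2 : (((-m : ℤ) * Real.pi / (k + 2) : ℝ) : ℂ) * Complex.I =
        -((m * Real.pi / (k + 2) : ℝ) : ℂ) * Complex.I := by push_cast; ring
    rw [h1, h2]
    linear_combination (-(-1 : ℂ) ^ m *
      (Complex.exp (-((m * Real.pi / (k + 2) : ℝ) : ℂ) * Complex.I)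
        - Complex.exp (((m * Real.pi / (k + 2) : ℝ) : ℂ) * Complex.I))) * Complex.I_sq
  have k1 := key 1
  rw [mul_one] at k1
  rw [key n, k1, qint]
  have hk : (0 : ℝ) < k + 2 := by positivity
  have hs : Real.sin (Real.pi / (k + 2)) ≠ 0 := by
    refine (Real.sin_pos_of_pos_of_lt_pi (by positivity) ?_).ne'
    rw [div_lt_iff₀ hk]
    nlinarith [Real.pi_pos, (Nat.cast_nonneg k : (0 : ℝ) ≤ k)]
  have hsc : ((Real.sin (Real.pi / (k + 2)) : ℝ) : ℂ) ≠ 0 := by exact_mod_cast hs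
  have hsg : ((-1 : ℂ)) ^ (n + 1) = -(-1) ^ n := by ring
  push_cast at hsc ⊢
  rw [hsg]
  simp only [zpow_natCast]
  field_simp

/-- Quantum factorial `[n]! = [1][2]⋯[n]`. -/
def qfact (k n : ℕ) : ℝ := ∏ i ∈ Finset.range n, qint k (i + 1)

/-- Quantum dimension of charge `n`: the value of a loop coloured by `n`. -/
def qdim (k n : ℕ) : ℝ := (-1) ^ n * qint k (n + 1)

/-- Fusion rules at level `k`: `a`, `b`, `c` may meet at a trivalent vertex. -/
def Admissible (k a b c : ℕ) : Prop :=
  Even (a + b + c) ∧ a ≤ b + c ∧ b ≤ a + c ∧ c ≤ a + b ∧ a + b + c ≤ 2 * k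

instance (k a b c : ℕ) : Decidable (Admissible k a b c) := by
  unfold Admissible; infer_instance

/-- Value of the theta graph with edges `a`, `b`, `c` (used for admissible triples only). -/
def theta (k a b c : ℕ) : ℝ :=
  let m := (a + b - c) / 2
  let n := (a + c - b) / 2
  let p := (b + c - a) / 2
  (-1) ^ (m + n + p) * (qfact k (m + n + p + 1) * qfact k m * qfact k n * qfact k p) /
    (qfact k (m + n) * qfact k (n + p) * qfact k (m + p))

/-- Value of the tetrahedron `Tet [a b e; c d f]`, whose four vertices are the triples
`(a,d,e)`, `(b,c,e)`, `(a,b,f)`, `(c,d,f)` (used for admissible triples only). -/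
def tet (k a b e c d f : ℕ) : ℝ :=
  let t₁ := (a + d + e) / 2
  let t₂ := (b + c + e) / 2
  let t₃ := (a + b + f) / 2
  let t₄ := (c + d + f) / 2
  let q₁ := (b + d + e + f) / 2
  let q₂ := (a + c + e + f) / 2
  let q₃ := (a + b + c + d) / 2
  ([q₁, q₂, q₃].map fun q => ([t₁, t₂, t₃, t₄].map fun t => qfact k (q - t)).prod).prod /
      ([a, b, c, d, e, f].map fun x => qfact k x).prod *
    ∑ s ∈ Finset.Icc (max (max t₁ t₂) (max t₃ t₄)) (min q₁ (min q₂ q₃)),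
      (-1) ^ s * qfact k (s + 1) /
        (([t₁, t₂, t₃, t₄].map fun t => qfact k (s - t)).prod *
          ([q₁, q₂, q₃].map fun q => qfact k (q - s)).prod)

/-- Unitary `6j`-symbol.  For four legs `a, b, c, d` in cyclic order with trivial total charge it is
the coefficient of the normalized tree `(b c) → y, (d a) → y` in the expansion of the normalized
tree `(a b) → x, (c d) → x`; it vanishes if one of the two trees is not admissible. -/
def sixJ (k a b c d x y : ℕ) : ℝ :=
  if Admissible k a b x ∧ Admissible k c d x ∧ Admissible k b c y ∧ Admissible k d a y then
    tet k a b y c d x * Real.sqrt (qdim k x * qdim k y) /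
      Real.sqrt (theta k a b x * theta k c d x * theta k b c y * theta k d a y)
  else 0

/-- Braiding phase of two anyons `a`, `b` with fusion channel `c`:
`(-1)^{(a+b-c)/2} A^{(a(a+2)+b(b+2)-c(c+2))/2}`. -/
def braidPhase (k a b c : ℕ) : ℂ :=
  (-1) ^ ((a + b - c) / 2) *
    kauffmanA k ^ (((a : ℤ) * (a + 2) + b * (b + 2) - c * (c + 2)) / 2)

/-! ### Four anyons of charge `2` at level `4`: the qutrit `2222` -/

/-- Common charge of the pairs `(1,2)` and `(3,4)` in four anyons of charge `2` with trivial total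
charge. -/
abbrev Channel : Type := {x : Fin 5 // Admissible 4 2 2 x}

/-- The fusion space, with orthonormal basis the normalized trees labelled by `Channel`. -/
abbrev Qutrit : Type := EuclideanSpace ℂ Channel

/-- The basis state `|x⟩`. -/
def ket (x : Channel) : Qutrit := EuclideanSpace.single x 1

/-- `|0⟩` -/
def ket0 : Qutrit := ket ⟨0, by decide⟩
/-- `|2⟩` -/
def ket2 : Qutrit := ket ⟨2, by decide⟩
/-- `|4⟩` -/
def ket4 : Qutrit := ket ⟨4, by decide⟩

/-- Matrix of the `F`-move from the trees `(1 2) → x, (3 4) → x` to the trees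
`(2 3) → y, (4 1) → y`. -/
def fMatrix : Matrix Channel Channel ℂ :=
  Matrix.of fun y x => ((sixJ 4 2 2 2 2 x.1 y.1 : ℝ) : ℂ)

/-- `R`-matrix of the exchange of two neighbouring anyons, in a tree where they fuse directly. -/
def rMatrix : Matrix Channel Channel ℂ :=
  Matrix.diagonal fun x => braidPhase 4 2 2 x.1

/-- The `σ₁`-braid: exchange of anyons `1` and `2`. -/
def sigma₁ : Module.End ℂ Qutrit := Matrix.toEuclideanLin rMatrix

/-- The `σ₂`-braid: exchange of anyons `2` and `3`. -/
def sigma₂ : Module.End ℂ Qutrit := Matrix.toEuclideanLin (fMatrix⁻¹ * rMatrix * fMatrix)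

/-- The Freedman fusion operation.  A pair of anyons of charge `4` is created out of the vacuum
between anyons `2` and `3`; one of them is fused with anyon `2` and the other with anyon `3`, the
outcome being charge `2` both times.  The matrix entry from `|x⟩` to `|y⟩` is the product of

* the amplitude for the new pair to be attached to the internal edge `x`, with charge `y` between
  its two members (legs `ω, ω', x, x` with `(ω ω') → 0`, recoupled to `(ω' x) → y`);
* the amplitude of the `F`-move from `(1 2) → x, (ω y) → x` to `(2 ω) → 2, (y 1) → 2`;
* the amplitude of the `F`-move from `(3 4) → x, (y ω') → x` to `(4 y) → 2, (ω' 3) → 2`.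

Here `1`, `2`, `3`, `4` are the four anyons, `ω` and `ω'` the new ones, and `y` the internal edge of
the resulting tree. -/
def ffo : Module.End ℂ Qutrit :=
  Matrix.toEuclideanLin <| Matrix.of fun y x : Channel =>
    ((sixJ 4 4 4 x.1 x.1 0 y.1 * sixJ 4 2 2 4 y.1 x.1 2 * sixJ 4 2 2 y.1 4 x.1 2 : ℝ) : ℂ)

/-- The basis `e₁ = (|0⟩ + |4⟩)/√2`, `e₂ = |2⟩`, `e₃ = (|0⟩ - |4⟩)/√2`. -/
def qutritBasis : Fin 3 → Qutrit :=
  ![((1 / Real.sqrt 2 : ℝ) : ℂ) • (ket0 + ket4), ket2,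
    ((1 / Real.sqrt 2 : ℝ) : ℂ) • (ket0 - ket4)]

/-- With respect to `(e₁, e₂, e₃)`, the matrix of the operation `T` is `M` up to a phase. -/
def Realizes (T : Module.End ℂ Qutrit) (M : Matrix (Fin 3) (Fin 3) ℂ) : Prop :=
  ∃ c : ℂ, ‖c‖ = 1 ∧ ∀ j, T (qutritBasis j) = c • ∑ i, M i j • qutritBasis i

/-! ### The matrices -/

/-- The phase `e^{iπt}`. -/
def phase (t : ℝ) : ℂ := Complex.exp (Complex.I * Real.pi * t)

/-- The matrix of the `σ₁`-braid with determinant `1`. -/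
def G₁ : Matrix (Fin 3) (Fin 3) ℂ :=
  !![0, 0, phase (7 / 9); 0, -phase (4 / 9), 0; phase (7 / 9), 0, 0]

/-- The matrix of the `σ₂`-braid with determinant `1`. -/
def G₂ : Matrix (Fin 3) (Fin 3) ℂ :=
  !![0, phase (7 / 9), 0; phase (7 / 9), 0, 0; 0, 0, -phase (4 / 9)]

/-- The matrix of the Freedman fusion operation with determinant `1`. -/
def FUM : Matrix (Fin 3) (Fin 3) ℂ :=
  !![-phase (2 / 3), 0, 0; 0, -phase (2 / 3), 0; 0, 0, phase (2 / 3)]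

/-- The gate `N`. -/
def gateN : Matrix (Fin 3) (Fin 3) ℂ :=
  !![phase (8 / 9), 0, 0; 0, phase (8 / 9), 0; 0, 0, phase (2 / 9)]

/-- The Blichfeldt generator `F(18,1,1)` of `D(18,1,1;2,1,1)`. -/
def blichfeldtF : Matrix (Fin 3) (Fin 3) ℂ :=
  !![phase (1 / 9), 0, 0; 0, phase (1 / 9), 0; 0, 0, phase (-2 / 9)]

/-- The Blichfeldt generator `E` of `D(18,1,1;2,1,1)`. -/
def blichfeldtE : Matrix (Fin 3) (Fin 3) ℂ := !![0, 1, 0; 0, 0, 1; 1, 0, 0]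

/-- The Blichfeldt generator `B̃` of `D(18,1,1;2,1,1)`. -/
def blichfeldtB : Matrix (Fin 3) (Fin 3) ℂ := !![-1, 0, 0; 0, 0, -1; 0, -1, 0]

end KauffmanJones

end

namespace KauffmanJones

/-! ### Unitary `6j`-symbols at level `4` -/

/-! At level 4 the quantum integers are `1, -√3, 2, -√3, 1`, so every `6j`-symbol needed is
explicit. On `|0⟩, |2⟩, |4⟩` the `F`-matrix is `½ [1, √2, 1; √2, 0, -√2; 1, -√2, 1]`, an involution
that fixes `e₁` and swaps `e₂`, `e₃`. Since `R₄ = -R₀`, the braid `σ₁` swaps `e₁`, `e₃` up to a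
scalar, and `σ₂ = F σ₁ F` swaps `e₁`, `e₂` likewise. Charge 4 fuses with `x` only to `4 - x`, so the
Freedman operation swaps `|0⟩`, `|4⟩` and fixes `|2⟩`, which is `diag(1, 1, -1)` in the new basis
(`realizes_sigma₁`, `realizes_sigma₂`, `realizes_ffo`). Realization up to phase is multiplicative
(`Realizes.mul`, `Realizes.pow`), so it remains to check identities between monomial matrices. Their
entries are signed powers of `z = e^{iπ/9}`, and `z ^ 9 = -1` settles them. -/

theorem qint_four_one : qint 4 1 = 1 := by
  norm_num [qint]

theorem qint_four_two : qint 4 2 = -Real.sqrt 3 := by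
  have h : (2 : ℝ) * Real.pi / 6 = Real.pi / 3 := by ring
  norm_num [qint, h]
  ring

theorem qint_four_three : qint 4 3 = 2 := by
  have h : (3 : ℝ) * Real.pi / 6 = Real.pi / 2 := by ring
  norm_num [qint, h]

theorem qint_four_four : qint 4 4 = -Real.sqrt 3 := by
  have h : (4 : ℝ) * Real.pi / 6 = Real.pi - Real.pi / 3 := by ring
  norm_num [qint, h, Real.sin_pi_sub]
  ring

theorem qint_four_five : qint 4 5 = 1 := by
  have h : (5 : ℝ) * Real.pi / 6 = Real.pi - Real.pi / 6 := by ring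
  norm_num [qint, h, Real.sin_pi_sub]

@[simp] theorem qfact_four_zero : qfact 4 0 = 1 := by simp [qfact]

theorem qfact_succ (k n : ℕ) : qfact k (n + 1) = qfact k n * qint k (n + 1) := by
  simp [qfact, Finset.prod_range_succ]

@[simp] theorem qfact_four_one : qfact 4 1 = 1 := by
  rw [qfact_succ, qfact_four_zero, qint_four_one, mul_one]

@[simp] theorem qfact_four_two : qfact 4 2 = -Real.sqrt 3 := by
  rw [qfact_succ, qfact_four_one, qint_four_two, one_mul]

@[simp] theorem qfact_four_three : qfact 4 3 = -(2 * Real.sqrt 3) := by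
  rw [qfact_succ, qfact_four_two, qint_four_three]; ring

@[simp] theorem qfact_four_four : qfact 4 4 = 6 := by
  rw [qfact_succ, qfact_four_three, qint_four_four]
  nlinarith [Real.mul_self_sqrt (show (0 : ℝ) ≤ 3 by norm_num)]

@[simp] theorem qfact_four_five : qfact 4 5 = 6 := by
  rw [qfact_succ, qfact_four_four, qint_four_five, mul_one]

@[simp] theorem qdim_four_zero : qdim 4 0 = 1 := by simp [qdim, qint_four_one]

@[simp] theorem qdim_four_two : qdim 4 2 = 2 := by simp [qdim, qint_four_three]

@[simp] theorem qdim_four_four : qdim 4 4 = 1 := by norm_num [qdim, qint_four_five]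

theorem sqrt_three_pow_four : Real.sqrt 3 ^ 4 = 9 := by
  rw [show 4 = 2 * 2 by rfl, pow_mul, Real.sq_sqrt (by norm_num)]; norm_num

@[simp] theorem theta_four_two_two_zero : theta 4 2 2 0 = 2 := by
  norm_num [theta]
  field_simp
  norm_num [pow_two]

@[simp] theorem theta_four_two_two_two : theta 4 2 2 2 = 2 / Real.sqrt 3 := by
  norm_num [theta]
  field_simp
  norm_num [pow_two]

@[simp] theorem theta_four_two_two_four : theta 4 2 2 4 = 1 := by
  norm_num [theta]
  field_simp

@[simp] theorem theta_four_four_four_zero : theta 4 4 4 0 = 1 := by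
  norm_num [theta]

@[simp] theorem theta_four_zero_zero_zero : theta 4 0 0 0 = 1 := by
  norm_num [theta]

@[simp] theorem theta_four_four_zero_four : theta 4 4 0 4 = 1 := by
  norm_num [theta]

@[simp] theorem theta_four_zero_four_four : theta 4 0 4 4 = 1 := by
  norm_num [theta]

@[simp] theorem theta_four_two_four_two : theta 4 2 4 2 = 1 := by
  norm_num [theta]
  field_simp
  norm_num [pow_two]

@[simp] theorem theta_four_four_two_two : theta 4 4 2 2 = 1 := by
  norm_num [theta]

@[simp] theorem theta_four_zero_two_two : theta 4 0 2 2 = 2 := by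
  norm_num [theta]
  field_simp
  norm_num [pow_two]

@[simp] theorem theta_four_two_zero_two : theta 4 2 0 2 = 2 := by
  norm_num [theta]
  field_simp
  norm_num [pow_two]

@[simp] theorem tet_four_two_two_zero_two_two_zero : tet 4 2 2 0 2 2 0 = 2 := by
  norm_num [tet]

@[simp] theorem tet_four_two_two_zero_two_two_two : tet 4 2 2 0 2 2 2 = 2 / Real.sqrt 3 := by
  norm_num [tet]
  field_simp
  norm_num [pow_two]

@[simp] theorem tet_four_two_two_zero_two_two_four : tet 4 2 2 0 2 2 4 = 1 := by
  norm_num [tet]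
  field_simp
  norm_num [sqrt_three_pow_four]

@[simp] theorem tet_four_two_two_two_two_two_zero : tet 4 2 2 2 2 2 0 = 2 / Real.sqrt 3 := by
  norm_num [tet]
  field_simp
  norm_num [pow_two]

-- The only tetrahedron here with a two-term sum: `s = 3` gives `-[4]!`, `s = 4` gives `[5]!`, and
-- these cancel because `[5] = 1`. This makes the central entry of the `F`-matrix vanish.
@[simp] theorem tet_four_two_two_two_two_two_two : tet 4 2 2 2 2 2 2 = 0 := by
  norm_num [tet, show Finset.Icc 3 4 = {3, 4} from rfl]

@[simp] theorem tet_four_two_two_two_two_two_four : tet 4 2 2 2 2 2 4 = -(1 / Real.sqrt 3) := by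
  norm_num [tet]
  field_simp
  norm_num [sqrt_three_pow_four]

@[simp] theorem tet_four_two_two_four_two_two_zero : tet 4 2 2 4 2 2 0 = 1 := by
  norm_num [tet]
  field_simp
  norm_num [sqrt_three_pow_four]

@[simp] theorem tet_four_two_two_four_two_two_two : tet 4 2 2 4 2 2 2 = -(1 / Real.sqrt 3) := by
  norm_num [tet]
  field_simp
  norm_num [sqrt_three_pow_four]

@[simp] theorem tet_four_two_two_four_two_two_four : tet 4 2 2 4 2 2 4 = 1 / 2 := by
  norm_num [tet]
  field_simp
  norm_num [pow_two]

@[simp] theorem tet_four_four_four_four_zero_zero_zero : tet 4 4 4 4 0 0 0 = 1 := by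
  norm_num [tet]

@[simp] theorem tet_four_two_two_two_four_four_zero : tet 4 2 2 2 4 4 0 = 1 := by
  norm_num [tet]
  field_simp
  norm_num [pow_two]

@[simp] theorem tet_four_four_four_two_two_two_zero : tet 4 4 4 2 2 2 0 = 1 := by
  norm_num [tet]
  field_simp
  norm_num [sqrt_three_pow_four]

@[simp] theorem tet_four_two_two_two_four_two_two : tet 4 2 2 2 4 2 2 = -(1 / Real.sqrt 3) := by
  norm_num [tet]
  field_simp
  norm_num [pow_two]

@[simp] theorem tet_four_two_two_two_two_four_two : tet 4 2 2 2 2 4 2 = -(1 / Real.sqrt 3) := by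
  norm_num [tet]
  field_simp
  norm_num [pow_two]

@[simp] theorem tet_four_four_four_zero_four_four_zero : tet 4 4 4 0 4 4 0 = 1 := by
  norm_num [tet]

@[simp] theorem tet_four_two_two_two_four_zero_four : tet 4 2 2 2 4 0 4 = 1 := by
  norm_num [tet]
  field_simp
  norm_num [pow_two]

@[simp] theorem tet_four_two_two_two_zero_four_four : tet 4 2 2 2 0 4 4 = 1 := by
  norm_num [tet]
  field_simp
  norm_num [pow_two]

@[simp] theorem sixJ_four_two_two_two_two_zero_zero : sixJ 4 2 2 2 2 0 0 = 1 / 2 := by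
  rw [sixJ, if_pos (by decide)]
  norm_num

@[simp] theorem sixJ_four_two_two_two_two_two_zero : sixJ 4 2 2 2 2 2 0 = Real.sqrt 2 / 2 := by
  rw [sixJ, if_pos (by decide)]
  norm_num
  field_simp
  norm_num
  field_simp
  norm_num

@[simp] theorem sixJ_four_two_two_two_two_four_zero : sixJ 4 2 2 2 2 4 0 = 1 / 2 := by
  rw [sixJ, if_pos (by decide)]
  norm_num

@[simp] theorem sixJ_four_two_two_two_two_zero_two : sixJ 4 2 2 2 2 0 2 = Real.sqrt 2 / 2 := by
  rw [sixJ, if_pos (by decide)]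
  norm_num
  field_simp
  norm_num
  field_simp

@[simp] theorem sixJ_four_two_two_two_two_two_two : sixJ 4 2 2 2 2 2 2 = 0 := by
  rw [sixJ, if_pos (by decide)]
  norm_num

@[simp] theorem sixJ_four_two_two_two_two_four_two : sixJ 4 2 2 2 2 4 2 = -(Real.sqrt 2 / 2) := by
  rw [sixJ, if_pos (by decide)]
  norm_num
  field_simp
  norm_num
  field_simp

@[simp] theorem sixJ_four_two_two_two_two_zero_four : sixJ 4 2 2 2 2 0 4 = 1 / 2 := by
  rw [sixJ, if_pos (by decide)]
  norm_num

@[simp] theorem sixJ_four_two_two_two_two_two_four : sixJ 4 2 2 2 2 2 4 = -(Real.sqrt 2 / 2) := by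
  rw [sixJ, if_pos (by decide)]
  norm_num
  field_simp
  norm_num
  field_simp

@[simp] theorem sixJ_four_two_two_two_two_four_four : sixJ 4 2 2 2 2 4 4 = 1 / 2 := by
  rw [sixJ, if_pos (by decide)]
  norm_num

-- From here on the symbols are the factors of the nonzero entries of `ffo`, those with `y = 4 - x`.
-- For `x = 2` both `F`-moves give `-1`, and the signs cancel.
@[simp] theorem sixJ_four_four_four_zero_zero_zero_four : sixJ 4 4 4 0 0 0 4 = 1 := by
  rw [sixJ, if_pos (by decide)]
  norm_num

@[simp] theorem sixJ_four_two_two_four_four_zero_two : sixJ 4 2 2 4 4 0 2 = 1 := by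
  rw [sixJ, if_pos (by decide)]
  norm_num

@[simp] theorem sixJ_four_four_four_two_two_zero_two : sixJ 4 4 4 2 2 0 2 = 1 := by
  rw [sixJ, if_pos (by decide)]
  norm_num

@[simp] theorem sixJ_four_two_two_four_two_two_two : sixJ 4 2 2 4 2 2 2 = -1 := by
  rw [sixJ, if_pos (by decide)]
  norm_num
  field_simp
  norm_num
  field_simp

@[simp] theorem sixJ_four_two_two_two_four_two_two : sixJ 4 2 2 2 4 2 2 = -1 := by
  rw [sixJ, if_pos (by decide)]
  norm_num
  field_simp
  norm_num
  field_simp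

@[simp] theorem sixJ_four_four_four_four_four_zero_zero : sixJ 4 4 4 4 4 0 0 = 1 := by
  rw [sixJ, if_pos (by decide)]
  norm_num

@[simp] theorem sixJ_four_two_two_four_zero_four_two : sixJ 4 2 2 4 0 4 2 = 1 := by
  rw [sixJ, if_pos (by decide)]
  norm_num

@[simp] theorem sixJ_four_two_two_zero_four_four_two : sixJ 4 2 2 0 4 4 2 = 1 := by
  rw [sixJ, if_pos (by decide)]
  norm_num

/-! ### Phases -/

theorem phase_add (s t : ℝ) : phase (s + t) = phase s * phase t := by
  simp only [phase, ← Complex.exp_add]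
  congr 1
  push_cast
  ring

theorem phase_nat_mul (n : ℕ) (t : ℝ) : phase (n * t) = phase t ^ n := by
  rw [phase, phase, ← Complex.exp_nat_mul]
  congr 1
  push_cast
  ring

theorem norm_phase (t : ℝ) : ‖phase t‖ = 1 := by
  have h : Complex.I * Real.pi * t = ((Real.pi * t : ℝ) : ℂ) * Complex.I := by push_cast; ring
  rw [phase, h, Complex.norm_exp_ofReal_mul_I]

theorem phase_zero : phase 0 = 1 := by simp [phase]

theorem phase_one : phase 1 = -1 := by
  rw [phase, Complex.ofReal_one, mul_one, mul_comm, Complex.exp_pi_mul_I]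

theorem phase_one_div_nine_pow_nine : phase (1 / 9) ^ 9 = -1 := by
  rw [← phase_nat_mul, ← phase_one]
  norm_num

/-- Only powers of `A⁴` are needed: the exponents of `A` in the three braid phases are `8`, `4` and
`-4`. -/
theorem kauffmanA_four_zpow (n : ℤ) : kauffmanA 4 ^ (4 * n) = phase (n / 3) := by
  have h := kauffmanA_zpow 4 (2 * n)
  rw [← mul_assoc, show (2 : ℤ) * 2 = 4 by norm_num, zpow_mul (-1 : ℂ)] at h
  rw [h, phase]
  norm_num
  congr 1
  ring

theorem braidPhase_four_zero : braidPhase 4 2 2 0 = phase (2 / 3) := by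
  have h := kauffmanA_four_zpow 2
  norm_num at h
  norm_num [braidPhase, h]

theorem braidPhase_four_two : braidPhase 4 2 2 2 = -phase (1 / 3) := by
  have h := kauffmanA_four_zpow 1
  norm_num at h
  norm_num [braidPhase, h]

theorem braidPhase_four_four : braidPhase 4 2 2 4 = -phase (2 / 3) := by
  have h := kauffmanA_four_zpow (-1)
  -- Exhibits `A⁻⁴` as the negative of the phase of channel 0, which is why `σ₁` exchanges `e₁` and
  -- `e₃`.
  have h' : phase (2 / 3) = phase 1 * phase (-(1 / 3)) := by rw [← phase_add]; norm_num
  rw [phase_one] at h'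
  norm_num at h h'
  norm_num [braidPhase, h, h']

/-! ### Operations on the qutrit -/

theorem sum_channel {M : Type*} [AddCommMonoid M] (f : Channel → M) :
    ∑ x, f x = f ⟨0, by decide⟩ + f ⟨2, by decide⟩ + f ⟨4, by decide⟩ := by
  have h : (Finset.univ : Finset Channel) =
      {⟨0, by decide⟩, ⟨2, by decide⟩, ⟨4, by decide⟩} := by decide
  rw [h, Finset.sum_insert (by decide), Finset.sum_insert (by decide), Finset.sum_singleton,
    add_assoc]

theorem forall_channel {p : Channel → Prop} :
    (∀ x, p x) ↔ p ⟨0, by decide⟩ ∧ p ⟨2, by decide⟩ ∧ p ⟨4, by decide⟩ := by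
  refine ⟨fun h => ⟨h _, h _, h _⟩, fun ⟨h0, h2, h4⟩ x => ?_⟩
  have hx : x = ⟨0, by decide⟩ ∨ x = ⟨2, by decide⟩ ∨ x = ⟨4, by decide⟩ := by
    revert x; decide
  rcases hx with rfl | rfl | rfl <;> assumption

theorem toEuclideanLin_ket (M : Matrix Channel Channel ℂ) (x : Channel) :
    Matrix.toEuclideanLin M (ket x) =
      M ⟨0, by decide⟩ x • ket0 + M ⟨2, by decide⟩ x • ket2 + M ⟨4, by decide⟩ x • ket4 := by
  have h : Matrix.toEuclideanLin M (ket x) = ∑ y, M y x • ket y := by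
    ext i
    simp [ket, Matrix.toLpLin_apply, Finset.sum_apply, Pi.single_apply]
  rw [h, sum_channel]
  rfl

theorem orthonormal_ket : Orthonormal ℂ ket :=
  EuclideanSpace.orthonormal_single

/-- Columns of the matrix are images of basis vectors, so composition keeps the order of the
factors; the phases multiply. -/
theorem Realizes.mul {S T : Module.End ℂ Qutrit} {M N : Matrix (Fin 3) (Fin 3) ℂ}
    (hS : Realizes S M) (hT : Realizes T N) : Realizes (S * T) (M * N) := by
  obtain ⟨c, hc, hS⟩ := hS
  obtain ⟨d, hd, hT⟩ := hT
  refine ⟨c * d, by simp [hc, hd], fun j => ?_⟩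
  simp only [Module.End.mul_apply, hT, map_smul, map_sum, hS, Matrix.mul_apply, Finset.sum_smul,
    Finset.smul_sum, smul_smul]
  rw [Finset.sum_comm]
  refine Finset.sum_congr rfl fun i _ => Finset.sum_congr rfl fun k _ => ?_
  congr 1
  ring

theorem Realizes.pow {T : Module.End ℂ Qutrit} {M : Matrix (Fin 3) (Fin 3) ℂ}
    (h : Realizes T M) (n : ℕ) : Realizes (T ^ n) (M ^ n) := by
  induction n with
  | zero => exact ⟨1, by simp, fun j => by simp [Matrix.one_apply]⟩
  | succ n ih => rw [pow_succ, pow_succ]; exact ih.mul h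

theorem sqrt_two_mul_self : (Real.sqrt 2 : ℂ) * Real.sqrt 2 = 2 := by
  rw [← Complex.ofReal_mul, Real.mul_self_sqrt (by norm_num)]; norm_num

theorem fMatrix_mul_self : fMatrix * fMatrix = 1 := by
  have h : ∀ i j, (fMatrix * fMatrix) i j = (1 : Matrix Channel Channel ℂ) i j := by
    simp only [forall_channel, Matrix.mul_apply, sum_channel]
    refine ⟨⟨?_, ?_, ?_⟩, ⟨?_, ?_, ?_⟩, ⟨?_, ?_, ?_⟩⟩ <;>
      simp [fMatrix] <;> grind [sqrt_two_mul_self]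
  exact Matrix.ext h

theorem fMatrix_inv : fMatrix⁻¹ = fMatrix := Matrix.inv_eq_right_inv fMatrix_mul_self

theorem orthonormal_qutritBasis : Orthonormal ℂ qutritBasis := by
  rw [orthonormal_iff_ite]
  intro i j
  have h : ((1 / Real.sqrt 2 : ℝ) : ℂ) * ((1 / Real.sqrt 2 : ℝ) : ℂ) = 1 / 2 := by
    rw [← Complex.ofReal_mul, div_mul_div_comm, Real.mul_self_sqrt (by norm_num)]
    norm_num
  fin_cases i <;> fin_cases j <;>
    simp [qutritBasis, ket0, ket2, ket4, inner_add_left, inner_add_right, inner_sub_left,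
      inner_sub_right, inner_smul_left, inner_smul_right,
      orthonormal_iff_ite.1 orthonormal_ket, -inner_self_eq_norm_sq_to_K] <;>
    grind [sqrt_two_mul_self]

theorem span_qutritBasis : Submodule.span ℂ (Set.range qutritBasis) = ⊤ := by
  refine orthonormal_qutritBasis.linearIndependent.span_eq_top_of_card_eq_finrank' ?_
  rw [finrank_euclideanSpace]
  rfl

theorem realizes_sigma₁ : Realizes sigma₁ G₁ := by
  -- The scalar undoes the determinant-one normalization: `7/9 - 1/9 = 2/3` and `4/9 - 1/9 = 1/3`.
  refine ⟨phase (-1 / 9), norm_phase _, fun j => ?_⟩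
  have h7 : phase (-1 / 9) * phase (7 / 9) = phase (2 / 3) := by rw [← phase_add]; norm_num
  have h4 : phase (-1 / 9) * phase (4 / 9) = phase 3⁻¹ := by rw [← phase_add]; norm_num
  fin_cases j <;>
    simp [qutritBasis, G₁, sigma₁, ket0, ket2, ket4, toEuclideanLin_ket, rMatrix,
      Fin.sum_univ_three, braidPhase_four_zero, braidPhase_four_two, braidPhase_four_four,
      ← h7, ← h4] <;> module

theorem realizes_fMatrix : Realizes (Matrix.toEuclideanLin fMatrix)
    !![1, 0, 0; 0, 0, 1; 0, 1, 0] := by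
  refine ⟨1, norm_one, fun j => ?_⟩
  have h : (Real.sqrt 2 : ℂ) ≠ 0 := by simp
  fin_cases j <;>
    simp [qutritBasis, ket0, ket2, ket4, toEuclideanLin_ket, fMatrix, Fin.sum_univ_three] <;>
    match_scalars <;> field_simp <;> grind [sqrt_two_mul_self]

theorem realizes_sigma₂ : Realizes sigma₂ G₂ := by
  have h := (realizes_fMatrix.mul realizes_sigma₁).mul realizes_fMatrix
  have hG : !![1, 0, 0; 0, 0, 1; 0, 1, 0] * G₁ * !![1, 0, 0; 0, 0, 1; 0, 1, 0] = G₂ := by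
    simp [G₁, G₂]
  have hs : sigma₂ = Matrix.toEuclideanLin fMatrix * sigma₁ * Matrix.toEuclideanLin fMatrix := by
    rw [sigma₂, fMatrix_inv, sigma₁]
    simp [Matrix.toLpLin_mul_same, Module.End.mul_eq_comp]
  rwa [hG, ← hs] at h

theorem realizes_ffo : Realizes ffo FUM := by
  -- Chosen so that `phase (1 / 3) * phase (2 / 3) = -1` turns `FUM` into `diag(1, 1, -1)`.
  refine ⟨phase (1 / 3), norm_phase _, fun j => ?_⟩
  have h : phase 3⁻¹ * phase (2 / 3) = -1 := by rw [← phase_add, ← phase_one]; norm_num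
  -- All entries with `y ≠ 4 - x` vanish because `(4, x, y)` is not admissible.
  have a1 : sixJ 4 4 4 0 0 0 0 = 0 := by rw [sixJ, if_neg (by decide)]
  have a2 : sixJ 4 4 4 0 0 0 2 = 0 := by rw [sixJ, if_neg (by decide)]
  have a3 : sixJ 4 4 4 2 2 0 0 = 0 := by rw [sixJ, if_neg (by decide)]
  have a4 : sixJ 4 4 4 2 2 0 4 = 0 := by rw [sixJ, if_neg (by decide)]
  have a5 : sixJ 4 4 4 4 4 0 2 = 0 := by rw [sixJ, if_neg (by decide)]
  have a6 : sixJ 4 4 4 4 4 0 4 = 0 := by rw [sixJ, if_neg (by decide)]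
  fin_cases j <;>
    simp [qutritBasis, FUM, ffo, ket0, ket2, ket4, toEuclideanLin_ket, Fin.sum_univ_three, a1,
      a2, a3, a4, a5, a6] <;>
    match_scalars <;> grind

/-! ### Matrix identities -/

theorem phase_div_nine (n : ℕ) : phase (n / 9) = phase (1 / 9) ^ n := by
  rw [← phase_nat_mul, mul_one_div]

/-- The square is diagonal, and the ninth power collects `z ^ 63 = -1` and `-z ^ 36 = -1`: what is
left is minus a transposition. The product with its analogue for `G₂` is then the 3-cycle `E`. -/
theorem G₁_pow_nine : G₁ ^ 9 = !![0, 0, -1; 0, -1, 0; -1, 0, 0] := by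
  have h := phase_one_div_nine_pow_nine
  have h7 := phase_div_nine 7
  have h4 := phase_div_nine 4
  push_cast at h7 h4
  have hsq : G₁ ^ 2 = Matrix.diagonal ![phase (1 / 9) ^ 14, phase (1 / 9) ^ 8,
      phase (1 / 9) ^ 14] := by
    rw [G₁, h7, h4]
    generalize phase (1 / 9) = z
    ext i j
    fin_cases i <;> fin_cases j <;> simp [pow_two, Matrix.mul_apply, Fin.sum_univ_three] <;> ring
  rw [show 9 = 2 * 4 + 1 by rfl, pow_succ, pow_mul, hsq, Matrix.diagonal_pow, G₁, h7, h4]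
  generalize phase (1 / 9) = z at h ⊢
  ext i j
  fin_cases i <;> fin_cases j <;> simp [Matrix.diagonal_mul] <;> grind

theorem G₂_sq : G₂ ^ 2 = Matrix.diagonal ![phase (1 / 9) ^ 14, phase (1 / 9) ^ 14,
    phase (1 / 9) ^ 8] := by
  have h7 := phase_div_nine 7
  have h4 := phase_div_nine 4
  push_cast at h7 h4
  rw [G₂, h7, h4]
  ext i j
  fin_cases i <;> fin_cases j <;> simp [pow_two, Matrix.mul_apply, Fin.sum_univ_three] <;> ring

theorem G₂_pow_nine : G₂ ^ 9 = !![0, -1, 0; -1, 0, 0; 0, 0, -1] := by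
  have h := phase_one_div_nine_pow_nine
  have h7 := phase_div_nine 7
  have h4 := phase_div_nine 4
  push_cast at h7 h4
  rw [show 9 = 2 * 4 + 1 by rfl, pow_succ, pow_mul, G₂_sq, Matrix.diagonal_pow, G₂, h7, h4]
  generalize phase (1 / 9) = z at h ⊢
  ext i j
  fin_cases i <;> fin_cases j <;> simp [Matrix.diagonal_mul] <;> grind

theorem blichfeldtE_eq : blichfeldtE = G₂ ^ 9 * G₁ ^ 9 := by
  rw [G₁_pow_nine, G₂_pow_nine]
  simp [blichfeldtE]

theorem blichfeldtB_eq : blichfeldtB = G₂ * G₁ * G₂ := by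
  have h := phase_one_div_nine_pow_nine
  have h7 := phase_div_nine 7
  have h4 := phase_div_nine 4
  push_cast at h7 h4
  rw [G₁, G₂, h7, h4, blichfeldtB]
  generalize phase (1 / 9) = z at h ⊢
  ext i j
  fin_cases i <;> fin_cases j <;> simp <;> grind

theorem gateN_mul_G₂_pow_four : gateN * G₂ ^ 4 = 1 := by
  have h := phase_one_div_nine_pow_nine
  have h8 := phase_div_nine 8
  have h2 := phase_div_nine 2
  push_cast at h8 h2
  rw [show 4 = 2 * 2 by rfl, pow_mul, G₂_sq, Matrix.diagonal_pow, gateN, h8, h2]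
  generalize phase (1 / 9) = z at h ⊢
  ext i j
  fin_cases i <;> fin_cases j <;> simp [Matrix.mul_diagonal] <;> grind

theorem gateN_eq : gateN = (G₂ ^ 4)⁻¹ :=
  (Matrix.inv_eq_left_inv gateN_mul_G₂_pow_four).symm

theorem gateN_inv : gateN⁻¹ = G₂ ^ 4 := Matrix.inv_eq_right_inv gateN_mul_G₂_pow_four

theorem blichfeldtF_eq : blichfeldtF = FUM ^ 3 * G₂ ^ 4 := by
  have h := phase_one_div_nine_pow_nine
  have h6 : phase (2 / 3) = phase (1 / 9) ^ 6 := by rw [← phase_nat_mul]; norm_num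
  -- The negative exponent is shifted by `1 = 9/9` to obtain a natural power of `z`; `h1` supplies
  -- `phase (-1) = -1`.
  have hm : phase (-2 / 9) = phase (-1) * phase (1 / 9) ^ 7 := by
    rw [← phase_nat_mul, ← phase_add]; norm_num
  have h1 : phase (-1) * phase 1 = 1 := by rw [← phase_add, ← phase_zero]; norm_num
  have hF : FUM = Matrix.diagonal ![-phase (2 / 3), -phase (2 / 3), phase (2 / 3)] := by
    ext i j
    fin_cases i <;> fin_cases j <;> rfl
  rw [phase_one] at h1
  rw [show 4 = 2 * 2 by rfl, pow_mul, G₂_sq, hF, Matrix.diagonal_pow, Matrix.diagonal_pow,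
    Matrix.diagonal_mul_diagonal, blichfeldtF, hm, h6]
  generalize phase (1 / 9) = z at h ⊢
  ext i j
  fin_cases i <;> fin_cases j <;> simp <;> grind

end KauffmanJones

open KauffmanJones in
theorem theorem3 :
    (Orthonormal ℂ qutritBasis ∧ Submodule.span ℂ (Set.range qutritBasis) = ⊤) ∧
    (Realizes sigma₁ G₁ ∧ Realizes sigma₂ G₂ ∧ Realizes ffo FUM) ∧
    (blichfeldtF = FUM ^ 3 * gateN⁻¹ ∧ gateN = (G₂ ^ 4)⁻¹ ∧
      Realizes (ffo ^ 3 * sigma₂ ^ 4) blichfeldtF) ∧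
    (blichfeldtE = G₂ ^ 9 * G₁ ^ 9 ∧ Realizes (sigma₂ ^ 9 * sigma₁ ^ 9) blichfeldtE) ∧
    (blichfeldtB = G₂ * G₁ * G₂ ∧ Realizes (sigma₂ * sigma₁ * sigma₂) blichfeldtB) := by
  refine ⟨⟨orthonormal_qutritBasis, span_qutritBasis⟩,
    ⟨realizes_sigma₁, realizes_sigma₂, realizes_ffo⟩, ⟨?_, gateN_eq, ?_⟩,
    ⟨blichfeldtE_eq, ?_⟩, ⟨blichfeldtB_eq, ?_⟩⟩
  · rw [gateN_inv, blichfeldtF_eq]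
  · exact blichfeldtF_eq ▸ (realizes_ffo.pow 3).mul (realizes_sigma₂.pow 4)
  · exact blichfeldtE_eq ▸ (realizes_sigma₂.pow 9).mul (realizes_sigma₁.pow 9)
  · exact blichfeldtB_eq ▸ (realizes_sigma₂.mul realizes_sigma₁).mul realizes_sigma₂
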